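/- A \emph{complete non-ambiguous tree} (CNAT) is a set of dotted cells in a rectangular grid (columns numbered from left to right, rows from top to bottom) such that: every row and every column contains a dotted cell; every dotted cell other than the top-left cell has either a dotted cell above it in its column or a dotted cell to its left in its row, but not both; and every dotted cell has either both a dotted cell below it in its column and a dotted cell to its right in its row, or neither. In the latter case it is called a \emph{leaf dot}. For a permutation $\pi$ of $\{1,\dots,n\}$, we say that a CNAT in the $n \times n$ grid has associated permutation $\pi$ if its leaf dots are exactly the cells in column $i$ and row $\pi(i)$, for $1 \le i \le n$. Let $b(n,2)$ be the number of permutations $\pi$ of $\{1,\dots,n\}$ that are associated with exactly $2$ CNATs. Then for every $n \ge 2$, \[ b(n,2) = (n-2)\cdot 2^{n-3}. \] -/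

import Mathlib

/-- A filling of a rectangular grid with `m` rows and `n` columns: the set of its dotted cells.
A cell is a pair `(column, row)`; columns are numbered from left to right and rows from top to
bottom, starting from `0`. -/
abbrev GridFilling (m n : ℕ) : Type := Finset (Fin n × Fin m)

namespace GridFilling

variable {m n : ℕ}

/-- Some dotted cell lies strictly above `c`, in the same column. -/
def DotAbove (T : GridFilling m n) (c : Fin n × Fin m) : Prop :=
  ∃ r : Fin m, r < c.2 ∧ (c.1, r) ∈ T

/-- Some dotted cell lies strictly to the left of `c`, in the same row. -/
def DotLeft (T : GridFilling m n) (c : Fin n × Fin m) : Prop :=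
  ∃ k : Fin n, k < c.1 ∧ (k, c.2) ∈ T

/-- Some dotted cell lies strictly below `c`, in the same column. -/
def DotBelow (T : GridFilling m n) (c : Fin n × Fin m) : Prop :=
  ∃ r : Fin m, c.2 < r ∧ (c.1, r) ∈ T

/-- Some dotted cell lies strictly to the right of `c`, in the same row. -/
def DotRight (T : GridFilling m n) (c : Fin n × Fin m) : Prop :=
  ∃ k : Fin n, c.1 < k ∧ (k, c.2) ∈ T

/-- Non-ambiguous trees. -/
structure IsNAT (T : GridFilling m n) : Prop where
  row_nonempty : ∀ r : Fin m, ∃ k : Fin n, (k, r) ∈ T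
  col_nonempty : ∀ k : Fin n, ∃ r : Fin m, (k, r) ∈ T
  /-- Every dotted cell other than the top-left cell has a dotted cell above it in its column or
  to its left in its row, but not both. -/
  unique_parent : ∀ c ∈ T, ¬ ((c.1 : ℕ) = 0 ∧ (c.2 : ℕ) = 0) →
    Xor (T.DotAbove c) (T.DotLeft c)

/-- Complete non-ambiguous trees: every dot has both a dot below it in its column and a dot to its
right in its row, or neither. -/
structure IsCNAT (T : GridFilling m n) : Prop extends IsNAT T where
  complete : ∀ c ∈ T, (T.DotBelow c ∧ T.DotRight c) ∨ (¬ T.DotBelow c ∧ ¬ T.DotRight c)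

/-- The set of leaf dots: the dots with no dot below in the same column and no dot to the right in
the same row. -/
def leafDots (T : GridFilling m n) : Set (Fin n × Fin m) :=
  {c | c ∈ T ∧ ¬ T.DotBelow c ∧ ¬ T.DotRight c}

end GridFilling

/-- The graphical representation of an `n`-permutation: the dots in column `i` and row `π i`. -/
def permDots {n : ℕ} (π : Equiv.Perm (Fin n)) : Set (Fin n × Fin n) :=
  {c | π c.1 = c.2}

/-- The set of CNATs whose associated permutation is `π`, that is, whose leaf dots form the
graphical representation of `π`. -/
def CNATsOf {n : ℕ} (π : Equiv.Perm (Fin n)) : Set (GridFilling n n) :=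
  {T | T.IsCNAT ∧ T.leafDots = permDots π}

/-- The number of CNATs whose associated permutation is `π`. -/
noncomputable def cnat {n : ℕ} (π : Equiv.Perm (Fin n)) : ℕ := (CNATsOf π).ncard

/-- The set of `n`-permutations with exactly `k` CNATs. -/
def permsWithCNATs (n k : ℕ) : Set (Equiv.Perm (Fin n)) := {π | cnat π = k}

/-! Turning a leaf of a CNAT into an internal dot with two leaf children inserts a column `w` and a
new bottom row. For a fixed `π`, undoing this at different columns `w` right of the bottom leaf
gives disjoint families of CNATs, so `cnat π` is at least the sum of `cnat (deletePerm π w)` over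
any set of such columns (`sum_cnat_deletePerm_le`). Three corner forms can be counted exactly: last
column with leaf in the last but one row, or the transposed condition (`cnat` is unchanged by the
deletion), and last but one position fixed (`cnat` is doubled). For indecomposable `π` outside these
forms, enough deletions stay indecomposable to force `cnat π ≥ 3`
(`IsIndecomposable.three_le_cnat`); decomposable permutations have no CNAT. With `b(n,j)` the number
of permutations having `j` CNATs, this yields `b(n+1,1) = 2 b(n,1)` and `b(n+1,2) = 2 b(n,2) +
b(n,1)` for `n ≥ 2`, whence the formula. -/

/-- The lowest dot of a column has nothing below it, so by completeness it is a leaf; likewise the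
rightmost dot of a row. Completeness thus becomes a bound on the position of the dots, which is
easier to transport than `IsCNAT`. -/
theorem mem_CNATsOf_iff {n : ℕ} (π : Equiv.Perm (Fin n)) (T : GridFilling n n) :
    T ∈ CNATsOf π ↔ (∀ k, (k, π k) ∈ T) ∧ (∀ k r, (k, r) ∈ T → r ≤ π k ∧ k ≤ π.symm r) ∧
      ∀ k r, (k, r) ∈ T → ¬ ((k : ℕ) = 0 ∧ (r : ℕ) = 0) →
        Xor (T.DotAbove (k, r)) (T.DotLeft (k, r)) := by
  constructor
  · rintro ⟨hT, hleaf⟩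
    have hiff : ∀ c, (c ∈ T ∧ ¬ T.DotBelow c ∧ ¬ T.DotRight c) ↔ π c.1 = c.2 := by
      intro c
      exact Set.ext_iff.mp hleaf c
    refine ⟨fun k => ((hiff (k, π k)).mpr rfl).1, ?_, fun k r h => hT.unique_parent (k, r) h⟩
    intro k r hkr
    constructor
    · obtain ⟨s, hs, hmax⟩ := (Finset.univ.filter fun s => (k, s) ∈ T).exists_max_image id
        ⟨r, by simpa using hkr⟩
      simp only [Finset.mem_filter, Finset.mem_univ, true_and, id] at hs hmax
      have hb : ¬ T.DotBelow (k, s) := fun ⟨t, hst, ht⟩ => absurd (hmax t ht) (not_le.mpr hst)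
      have := (hT.complete _ hs).resolve_left fun h => hb h.1
      rw [(hiff (k, s)).mp ⟨hs, this⟩]
      exact hmax r hkr
    · obtain ⟨s, hs, hmax⟩ := (Finset.univ.filter fun s => (s, r) ∈ T).exists_max_image id
        ⟨k, by simpa using hkr⟩
      simp only [Finset.mem_filter, Finset.mem_univ, true_and, id] at hs hmax
      have hb : ¬ T.DotRight (s, r) := fun ⟨t, hst, ht⟩ => absurd (hmax t ht) (not_le.mpr hst)
      have := (hT.complete _ hs).resolve_left fun h => hb h.2
      have hsr : π s = r := (hiff (s, r)).mp ⟨hs, this⟩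
      rw [← hsr, Equiv.symm_apply_apply]
      exact hmax k hkr
  · rintro ⟨ha, hb, hc⟩
    have key : ∀ c ∈ T, (c.2 = π c.1 ∧ ¬ T.DotBelow c ∧ ¬ T.DotRight c) ∨
        (c.2 ≠ π c.1 ∧ T.DotBelow c ∧ T.DotRight c) := by
      rintro ⟨k, r⟩ h
      by_cases hr : r = π k
      · subst hr
        refine Or.inl ⟨rfl, ?_, ?_⟩
        · rintro ⟨s, hs, hsT⟩
          exact absurd (hb _ _ hsT).1 (not_le.mpr hs)
        · rintro ⟨s, hs, hsT⟩
          have := (hb _ _ hsT).2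
          simp only [Equiv.symm_apply_apply] at this
          exact absurd this (not_le.mpr hs)
      · refine Or.inr ⟨hr, ⟨π k, lt_of_le_of_ne (hb _ _ h).1 hr, ha k⟩,
          ⟨π.symm r, lt_of_le_of_ne (hb _ _ h).2 ?_, ?_⟩⟩
        · rintro h'
          exact hr (by simpa using (congrArg π h').symm)
        · simpa using ha (π.symm r)
    refine ⟨⟨⟨fun r => ⟨π.symm r, by simpa using ha (π.symm r)⟩, fun k => ⟨π k, ha k⟩,
      fun c => hc c.1 c.2⟩, fun c h => ?_⟩, ?_⟩
    · rcases key c h with h | h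
      · exact Or.inr h.2
      · exact Or.inl h.2
    · ext c
      constructor
      · rintro ⟨hT, h1, h2⟩
        rcases key c hT with h | h
        · exact h.1.symm
        · exact absurd h.2.1 h1
      · intro h
        have h' : π c.1 = c.2 := h
        have hT : c ∈ T := by simpa [h'] using ha c.1
        rcases key c hT with h | h
        · exact ⟨hT, h.2⟩
        · exact absurd h'.symm h.1

/-! ### Transposition, and the split by the parent of a given leaf -/

namespace GridFilling

/-- Reflection of a filling in the main diagonal. -/
def transpose {m n : ℕ} (T : GridFilling m n) : GridFilling n m :=
  T.map (Equiv.prodComm _ _).toEmbedding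

@[simp]
theorem mem_transpose {m n : ℕ} {T : GridFilling m n} {k : Fin m} {r : Fin n} :
    (k, r) ∈ T.transpose ↔ (r, k) ∈ T := by
  simp [transpose]

@[simp]
theorem transpose_transpose {m n : ℕ} (T : GridFilling m n) : T.transpose.transpose = T := by
  ext ⟨k, r⟩
  simp

theorem dotAbove_transpose {m n : ℕ} {T : GridFilling m n} {k : Fin m} {r : Fin n} :
    T.transpose.DotAbove (k, r) ↔ T.DotLeft (r, k) := by
  simp [DotAbove, DotLeft]

theorem dotLeft_transpose {m n : ℕ} {T : GridFilling m n} {k : Fin m} {r : Fin n} :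
    T.transpose.DotLeft (k, r) ↔ T.DotAbove (r, k) := by
  simp [DotAbove, DotLeft]

end GridFilling

open GridFilling

theorem transpose_mem_CNATsOf {n : ℕ} {π : Equiv.Perm (Fin n)} {T : GridFilling n n}
    (h : T ∈ CNATsOf π) : T.transpose ∈ CNATsOf π.symm := by
  rw [mem_CNATsOf_iff] at h ⊢
  obtain ⟨ha, hb, hc⟩ := h
  refine ⟨fun k => ?_, fun k r h => ?_, fun k r h h0 => ?_⟩
  · simpa using ha (π.symm k)
  · rw [mem_transpose] at h
    exact (hb _ _ h).symm
  · rw [mem_transpose] at h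
    rw [dotAbove_transpose, dotLeft_transpose, xor_comm]
    exact hc _ _ h fun h' => h0 h'.symm

/-- The CNATs of `π` in which the leaf dot of column `w` has its parent to its left. -/
def CNATsLeft {n : ℕ} (π : Equiv.Perm (Fin n)) (w : Fin n) : Set (GridFilling n n) :=
  {T | T ∈ CNATsOf π ∧ T.DotLeft (w, π w)}

/-- The CNATs of `π` in which the leaf dot of column `w` has its parent above it. -/
def CNATsAbove {n : ℕ} (π : Equiv.Perm (Fin n)) (w : Fin n) : Set (GridFilling n n) :=
  {T | T ∈ CNATsOf π ∧ T.DotAbove (w, π w)}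

theorem transpose_injective {m n : ℕ} :
    Function.Injective (GridFilling.transpose : GridFilling m n → GridFilling n m) :=
  Function.LeftInverse.injective (g := GridFilling.transpose) transpose_transpose

theorem cnat_symm_le {n : ℕ} (π : Equiv.Perm (Fin n)) : cnat π ≤ cnat π.symm :=
  Set.ncard_le_ncard_of_injOn GridFilling.transpose (fun _ h => transpose_mem_CNATsOf h)
    transpose_injective.injOn (Set.toFinite _)

theorem cnat_symm {n : ℕ} (π : Equiv.Perm (Fin n)) : cnat π.symm = cnat π :=
  le_antisymm (by simpa using cnat_symm_le π.symm) (cnat_symm_le π)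

theorem ncard_CNATsAbove {n : ℕ} (π : Equiv.Perm (Fin n)) (w : Fin n) :
    (CNATsAbove π w).ncard = (CNATsLeft π.symm (π w)).ncard := by
  have hA : ∀ T ∈ CNATsAbove π w, T.transpose ∈ CNATsLeft π.symm (π w) := fun T hT =>
    ⟨transpose_mem_CNATsOf hT.1, by rw [dotLeft_transpose]; simpa using hT.2⟩
  have hB : ∀ T ∈ CNATsLeft π.symm (π w), T.transpose ∈ CNATsAbove π w := fun T hT =>
    ⟨by simpa using transpose_mem_CNATsOf hT.1, by
      rw [dotAbove_transpose]; simpa using hT.2⟩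
  exact le_antisymm
    (Set.ncard_le_ncard_of_injOn _ hA transpose_injective.injOn (Set.toFinite _))
    (Set.ncard_le_ncard_of_injOn _ hB transpose_injective.injOn (Set.toFinite _))

theorem cnat_eq_left_add_above {n : ℕ} (π : Equiv.Perm (Fin n)) (w : Fin n)
    (h0 : ¬ ((w : ℕ) = 0 ∧ (π w : ℕ) = 0)) :
    cnat π = (CNATsLeft π w).ncard + (CNATsAbove π w).ncard := by
  have hx : ∀ T ∈ CNATsOf π, Xor (T.DotAbove (w, π w)) (T.DotLeft (w, π w)) := fun T hT => by
    rw [mem_CNATsOf_iff] at hT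
    exact hT.2.2 _ _ (hT.1 w) h0
  rw [cnat, ← Set.ncard_union_eq _ (Set.toFinite _) (Set.toFinite _)]
  · congr 1
    ext T
    constructor
    · intro hT
      rcases hx T hT with h | h
      · exact Or.inr ⟨hT, h.1⟩
      · exact Or.inl ⟨hT, h.1⟩
    · rintro (h | h) <;> exact h.1
  · rw [Set.disjoint_left]
    intro T h1 h2
    rcases hx T h1.1 with h | h
    · exact h.2 h1.2
    · exact h.2 h2.2

/-- In a permutation with at least two points, a fixed last point forbids CNATs. -/
theorem cnat_eq_zero_of_fix_last {m : ℕ} (hm : 1 ≤ m) (π : Equiv.Perm (Fin (m + 1)))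
    (h : π (Fin.last m) = Fin.last m) : cnat π = 0 := by
  rw [cnat, Set.ncard_eq_zero, Set.eq_empty_iff_forall_notMem]
  intro T hT
  rw [mem_CNATsOf_iff] at hT
  obtain ⟨ha, hb, hc⟩ := hT
  have hs : π.symm (Fin.last m) = Fin.last m := by rw [Equiv.symm_apply_eq, h]
  have hl := ha (Fin.last m)
  rw [h] at hl
  -- A parent above the corner leaf lies in the last column, which would force the leaf of its row
  -- into that column too; but that column has only the corner leaf. The left case is symmetric.
  rcases hc _ _ hl (by simp; omega) with ⟨⟨r, hr, hrT⟩, -⟩ | ⟨⟨k, hk, hkT⟩, -⟩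
  · have h1 := (hb _ _ hrT).2
    have h2 : π.symm r = Fin.last m := le_antisymm (Fin.le_last _) h1
    rw [Equiv.symm_apply_eq, h] at h2
    exact absurd h2 hr.ne
  · have h1 := (hb _ _ hkT).1
    have h2 : π k = Fin.last m := le_antisymm (Fin.le_last _) h1
    rw [← h] at h2
    exact absurd (π.injective h2) hk.ne

/-! ### Inserting and deleting a column of a permutation -/

/-- `π` arises from `σ` by inserting the column `w` and a new bottom row, where the leaf dot of `σ`
in row `q` is moved down to the bottom row, and the new column receives its leaf in row `q`. -/
def IsInsertion {m : ℕ} (σ : Equiv.Perm (Fin m)) (q : Fin m) (w : Fin (m + 1))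
    (π : Equiv.Perm (Fin (m + 1))) : Prop :=
  π w = q.castSucc ∧
    ∀ i, π (w.succAbove i) = if σ i = q then Fin.last m else (σ i).castSucc

/-- The permutation arising from `σ` by inserting the column `w` and a new bottom row. -/
def insertPerm {m : ℕ} (σ : Equiv.Perm (Fin m)) (q : Fin m) (w : Fin (m + 1)) :
    Equiv.Perm (Fin (m + 1)) :=
  ((finSuccEquiv' w).trans ((Equiv.optionCongr σ).trans (finSuccEquiv' (Fin.last m)).symm)).trans
    (Equiv.swap q.castSucc (Fin.last m))

theorem isInsertion_insertPerm {m : ℕ} (σ : Equiv.Perm (Fin m)) (q : Fin m) (w : Fin (m + 1)) :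
    IsInsertion σ q w (insertPerm σ q w) := by
  refine ⟨by simp [insertPerm], fun i => ?_⟩
  simp only [insertPerm, Equiv.trans_apply, finSuccEquiv'_succAbove, Equiv.optionCongr_apply,
    Option.map_some, finSuccEquiv'_symm_some, Fin.succAbove_last]
  split_ifs with h
  · rw [h, Equiv.swap_apply_left]
  · rw [Equiv.swap_apply_of_ne_of_ne]
    · exact fun h' => h (Fin.castSucc_injective _ h')
    · exact Fin.castSucc_ne_last _

/-- The permutation obtained from `π` by deleting the column `w` and the bottom row, the leaf dot
in the bottom row being moved up to the row of the deleted one. -/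
def deletePerm {m : ℕ} (π : Equiv.Perm (Fin (m + 1))) (w : Fin (m + 1)) : Equiv.Perm (Fin m) :=
  Equiv.removeNone ((finSuccEquiv' w).symm.trans (π.trans (finSuccEquiv' (Fin.last m))))

theorem castSucc_deletePerm {m : ℕ} (π : Equiv.Perm (Fin (m + 1))) {w : Fin (m + 1)}
    (i : Fin m) :
    (deletePerm π w i).castSucc =
      if π (w.succAbove i) = Fin.last m then π w else π (w.succAbove i) := by
  have key : ∀ {j : Fin (m + 1)} {x : Fin m},
      some x = finSuccEquiv' (Fin.last m) j → x.castSucc = j := fun {j x} h => by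
    rw [← Fin.succAbove_last, finSuccEquiv'_eq_some.mp h.symm]
  split_ifs with h
  · apply key
    rw [deletePerm, Equiv.removeNone_none]
    · simp
    · simp [h]
  · apply key
    rw [deletePerm, Equiv.removeNone_some]
    · simp
    · obtain ⟨j, hj⟩ := Fin.exists_castSucc_eq.mpr h
      exact ⟨j, by simp [← hj]⟩

theorem isInsertion_deletePerm {m : ℕ} (π : Equiv.Perm (Fin (m + 1))) {w : Fin (m + 1)}
    {q : Fin m} (hq : π w = q.castSucc) : IsInsertion (deletePerm π w) q w π := by
  refine ⟨hq, fun i => ?_⟩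
  have h := castSucc_deletePerm π (w := w) i
  by_cases hl : π (w.succAbove i) = Fin.last m
  · rw [if_pos hl, hq] at h
    rw [if_pos (Fin.castSucc_injective _ h), hl]
  · rw [if_neg hl] at h
    rw [if_neg, h]
    rintro h'
    rw [h', ← hq] at h
    exact Fin.succAbove_ne w i (π.injective h).symm

namespace IsInsertion

variable {m : ℕ} {σ σ' : Equiv.Perm (Fin m)} {q : Fin m} {w : Fin (m + 1)}
  {π π' : Equiv.Perm (Fin (m + 1))}

theorem perm_eq (h : IsInsertion σ q w π) (h' : IsInsertion σ q w π') : π = π' := by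
  ext i
  rcases Fin.eq_self_or_eq_succAbove w i with rfl | ⟨j, rfl⟩
  · rw [h.1, h'.1]
  · rw [h.2, h'.2]

theorem castSucc_apply (h : IsInsertion σ q w π) (i : Fin m) :
    (σ i).castSucc = if π (w.succAbove i) = Fin.last m then π w else π (w.succAbove i) := by
  rw [h.2, h.1]
  by_cases hi : σ i = q
  · simp [hi]
  · simp [hi]

theorem eq_of_perm (h : IsInsertion σ q w π) (h' : IsInsertion σ' q w π) : σ = σ' := by
  ext i
  have := (h.castSucc_apply i).trans (h'.castSucc_apply i).symm
  rw [Fin.castSucc_injective _ this]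

theorem symm_last (h : IsInsertion σ q w π) : π.symm (Fin.last m) = w.succAbove (σ.symm q) := by
  rw [Equiv.symm_apply_eq, h.2]
  simp

theorem symm_castSucc (h : IsInsertion σ q w π) {r : Fin m} (hr : r ≠ q) :
    π.symm r.castSucc = w.succAbove (σ.symm r) := by
  rw [Equiv.symm_apply_eq, h.2]
  simp [hr]

theorem symm_castSucc_self (h : IsInsertion σ q w π) : π.symm q.castSucc = w := by
  rw [Equiv.symm_apply_eq, h.1]

end IsInsertion

/-! ### Inserting a cherry into a CNAT -/

/-- The filling obtained by inserting column `w` and a new bottom row, and by turning the leaf dot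
`(p, q)` into an internal dot with two leaf children. -/
def insertCherry {m : ℕ} (w : Fin (m + 1)) (p q : Fin m) (T : GridFilling m m) :
    GridFilling (m + 1) (m + 1) :=
  insert (w.succAbove p, Fin.last m)
    (insert (w, q.castSucc) (T.image fun c => (w.succAbove c.1, c.2.castSucc)))

section insertCherry

variable {m : ℕ} {w : Fin (m + 1)} {p q : Fin m} {T : GridFilling m m}

theorem succAbove_mem_insertCherry {k r : Fin m} :
    (w.succAbove k, r.castSucc) ∈ insertCherry w p q T ↔ (k, r) ∈ T := by
  simp only [insertCherry, Finset.mem_insert, Finset.mem_image, Prod.mk.injEq, Prod.exists]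
  constructor
  · rintro (⟨-, h⟩ | ⟨h, -⟩ | ⟨a, b, h, h1, h2⟩)
    · exact absurd h (Fin.castSucc_ne_last _)
    · exact absurd h (Fin.succAbove_ne _ _)
    · rwa [Fin.succAbove_right_injective h1, Fin.castSucc_injective _ h2] at h
  · exact fun h => Or.inr (Or.inr ⟨k, r, h, rfl, rfl⟩)

theorem mem_insertCherry_last {k : Fin (m + 1)} :
    (k, Fin.last m) ∈ insertCherry w p q T ↔ k = w.succAbove p := by
  simp only [insertCherry, Finset.mem_insert, Finset.mem_image, Prod.mk.injEq, Prod.exists]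
  constructor
  · rintro (h | ⟨-, h⟩ | ⟨a, b, h, h1, h2⟩)
    · exact h.1
    · exact absurd h.symm (Fin.castSucc_ne_last _)
    · exact absurd h2 (Fin.castSucc_ne_last _)
  · exact fun h => Or.inl ⟨h, trivial⟩

theorem mem_insertCherry_col {r : Fin (m + 1)} :
    (w, r) ∈ insertCherry w p q T ↔ r = q.castSucc := by
  simp only [insertCherry, Finset.mem_insert, Finset.mem_image, Prod.mk.injEq, Prod.exists]
  constructor
  · rintro (h | h | ⟨a, b, h, h1, h2⟩)
    · exact absurd h.1.symm (Fin.succAbove_ne _ _)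
    · exact h.2
    · exact absurd h1 (Fin.succAbove_ne _ _)
  · exact fun h => Or.inr (Or.inl ⟨trivial, h⟩)

theorem insertCherry_injective :
    Function.Injective (insertCherry w p q) := by
  intro T T' h
  ext ⟨k, r⟩
  rw [← succAbove_mem_insertCherry (w := w) (p := p) (q := q), h, succAbove_mem_insertCherry]

/-- Cells of the enlarged grid. -/
theorem insert_cell_cases (w : Fin (m + 1)) (k r : Fin (m + 1)) :
    r = Fin.last m ∨ k = w ∨ ∃ a b, k = w.succAbove a ∧ r = Fin.castSucc b := by
  by_cases hr : r = Fin.last m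
  · exact Or.inl hr
  · obtain ⟨b, rfl⟩ := Fin.exists_castSucc_eq.mpr hr
    rcases Fin.eq_self_or_eq_succAbove w k with rfl | ⟨a, rfl⟩
    · exact Or.inr (Or.inl rfl)
    · exact Or.inr (Or.inr ⟨a, b, rfl, rfl⟩)

theorem dotAbove_insertCherry {k r : Fin m} :
    (insertCherry w p q T).DotAbove (w.succAbove k, r.castSucc) ↔ T.DotAbove (k, r) := by
  constructor
  · rintro ⟨s, hs, hsT⟩
    obtain ⟨b, rfl⟩ := Fin.exists_castSucc_eq.mpr (ne_of_lt (hs.trans (Fin.castSucc_lt_last r)))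
    exact ⟨b, hs, succAbove_mem_insertCherry.mp hsT⟩
  · rintro ⟨b, hb, hbT⟩
    exact ⟨b.castSucc, hb, succAbove_mem_insertCherry.mpr hbT⟩

theorem dotLeft_insertCherry_of {k r : Fin m} (h : T.DotLeft (k, r)) :
    (insertCherry w p q T).DotLeft (w.succAbove k, r.castSucc) := by
  obtain ⟨b, hb, hbT⟩ := h
  exact ⟨w.succAbove b, Fin.succAbove_lt_succAbove_iff.mpr hb, succAbove_mem_insertCherry.mpr hbT⟩

/-- The only new dot that could serve as a left neighbour of an old one is `(w, q)`; `hk` puts it on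
the wrong side. -/
theorem dotLeft_of_insertCherry {k r : Fin m} (hk : r = q → w.succAbove k < w)
    (h : (insertCherry w p q T).DotLeft (w.succAbove k, r.castSucc)) : T.DotLeft (k, r) := by
  obtain ⟨b, hb, hbT⟩ := h
  rcases Fin.eq_self_or_eq_succAbove w b with rfl | ⟨j, rfl⟩
  · have := mem_insertCherry_col.mp hbT
    exact absurd hb (hk (Fin.castSucc_injective _ this)).asymm
  · exact ⟨j, Fin.succAbove_lt_succAbove_iff.mp hb, succAbove_mem_insertCherry.mp hbT⟩

end insertCherry

/-- Some column lies left of `w`, so `w` is not the first column and the root cell stays the root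
cell. -/
theorem succAbove_eq_zero_val {m : ℕ} {w : Fin (m + 1)} {p k : Fin m} (hw : w.succAbove p < w)
    (hk : (k : ℕ) = 0) : ((w.succAbove k : Fin (m + 1)) : ℕ) = 0 := by
  have h : w.succAbove k ≤ w.succAbove p :=
    Fin.succAbove_le_succAbove_iff.mpr (by rw [Fin.le_def]; omega)
  rw [Fin.succAbove_of_castSucc_lt]
  · simpa using hk
  · by_contra h'
    rw [Fin.succAbove_of_le_castSucc _ _ (not_lt.mp h')] at h
    have h1 := h.trans_lt hw
    rw [Fin.lt_def] at h1
    rw [not_lt, Fin.le_def] at h'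
    simp at h1 h'
    omega

section

variable {m : ℕ} {σ : Equiv.Perm (Fin m)} {q : Fin m} {w : Fin (m + 1)}
  {π : Equiv.Perm (Fin (m + 1))}

/-- Replacing a leaf dot by an internal dot with two leaf children produces a CNAT. -/
theorem insertCherry_mem (h : IsInsertion σ q w π) (hw : π.symm (Fin.last m) < w)
    {T : GridFilling m m} (hT : T ∈ CNATsOf σ) :
    insertCherry w (σ.symm q) q T ∈ CNATsOf π := by
  rw [h.symm_last] at hw
  rw [mem_CNATsOf_iff] at hT ⊢
  obtain ⟨ha, hb, hc⟩ := hT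
  refine ⟨fun k => ?_, fun k r hkr => ?_, fun k r hkr h0 => ?_⟩
  · rcases Fin.eq_self_or_eq_succAbove w k with rfl | ⟨j, rfl⟩
    · rw [h.1, mem_insertCherry_col]
    · rw [h.2]
      split_ifs with hj
      · rw [mem_insertCherry_last, ← hj, Equiv.symm_apply_apply]
      · rw [succAbove_mem_insertCherry]
        exact ha j
  · rcases insert_cell_cases w k r with rfl | rfl | ⟨a, b, rfl, rfl⟩
    · rw [mem_insertCherry_last] at hkr
      rw [h.symm_last, hkr, h.2]
      simp
    · rw [mem_insertCherry_col] at hkr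
      rw [hkr, h.1, h.symm_castSucc_self]
      exact ⟨le_rfl, le_rfl⟩
    · rw [succAbove_mem_insertCherry] at hkr
      have := hb _ _ hkr
      constructor
      · rw [h.2]
        split_ifs
        · exact Fin.le_last _
        · exact this.1
      · by_cases hbq : b = q
        · rw [hbq, h.symm_castSucc_self]
          rw [hbq] at this
          exact ((Fin.succAbove_le_succAbove_iff.mpr this.2).trans_lt hw).le
        · rw [h.symm_castSucc hbq]
          exact Fin.succAbove_le_succAbove_iff.mpr this.2
  · have hpq : (σ.symm q, q) ∈ T := by simpa using ha (σ.symm q)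
    rcases insert_cell_cases w k r with rfl | rfl | ⟨a, b, rfl, rfl⟩
    · rw [mem_insertCherry_last] at hkr
      subst hkr
      refine Or.inl ⟨⟨q.castSucc, Fin.castSucc_lt_last _, succAbove_mem_insertCherry.mpr hpq⟩, ?_⟩
      rintro ⟨k, hk, hkT⟩
      exact hk.ne (mem_insertCherry_last.mp hkT)
    · rw [mem_insertCherry_col] at hkr
      subst hkr
      refine Or.inr ⟨⟨_, hw, succAbove_mem_insertCherry.mpr hpq⟩, ?_⟩
      rintro ⟨s, hs, hsT⟩
      exact hs.ne (mem_insertCherry_col.mp hsT)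
    · rw [succAbove_mem_insertCherry] at hkr
      have hx := hc _ _ hkr fun h' => h0 ⟨succAbove_eq_zero_val hw h'.1, by simpa using h'.2⟩
      rw [dotAbove_insertCherry]
      have hl : (insertCherry w (σ.symm q) q T).DotLeft (w.succAbove a, b.castSucc) ↔
          T.DotLeft (a, b) := by
        refine ⟨dotLeft_of_insertCherry fun hbq => ?_, dotLeft_insertCherry_of⟩
        have := (hb _ _ hkr).2
        rw [hbq] at this
        exact (Fin.succAbove_le_succAbove_iff.mpr this).trans_lt hw
      rw [hl]
      exact hx

end

/-! ### The lower bound by deletions -/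

/-- The dot `(π⁻¹ (last), π w)` is present and is the lowest internal dot of its column. -/
def LowestInternalAt {m : ℕ} (π : Equiv.Perm (Fin (m + 1))) (w : Fin (m + 1))
    (T : GridFilling (m + 1) (m + 1)) : Prop :=
  (π.symm (Fin.last m), π w) ∈ T ∧
    ∀ r, (π.symm (Fin.last m), r) ∈ T → r ≤ π w ∨ r = Fin.last m

/-- The lowest internal dot above the bottom leaf reveals the row `π w`, hence `w`: this makes the
images of `insertCherry` for different `w` disjoint. -/
theorem LowestInternalAt.unique {m : ℕ} {π : Equiv.Perm (Fin (m + 1))} {w w' : Fin (m + 1)}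
    {T : GridFilling (m + 1) (m + 1)} (hw : π w ≠ Fin.last m) (hw' : π w' ≠ Fin.last m)
    (h : LowestInternalAt π w T) (h' : LowestInternalAt π w' T) : w = w' :=
  π.injective (le_antisymm ((h'.2 _ h.1).resolve_right hw) ((h.2 _ h'.1).resolve_right hw'))

theorem apply_ne_last_of_symm_lt {m : ℕ} {π : Equiv.Perm (Fin (m + 1))} {w : Fin (m + 1)}
    (hw : π.symm (Fin.last m) < w) : π w ≠ Fin.last m := by
  intro h
  rw [← h, Equiv.symm_apply_apply] at hw
  exact lt_irrefl _ hw

section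

variable {m : ℕ} {σ : Equiv.Perm (Fin m)} {q : Fin m} {w : Fin (m + 1)}
  {π : Equiv.Perm (Fin (m + 1))}

theorem lowestInternalAt_insertCherry (h : IsInsertion σ q w π)
    {T : GridFilling m m} (hT : T ∈ CNATsOf σ) :
    LowestInternalAt π w (insertCherry w (σ.symm q) q T) := by
  rw [mem_CNATsOf_iff] at hT
  rw [LowestInternalAt, h.symm_last, h.1]
  refine ⟨succAbove_mem_insertCherry.mpr (by simpa using hT.1 (σ.symm q)), fun r hr => ?_⟩
  by_cases hl : r = Fin.last m
  · exact Or.inr hl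
  · obtain ⟨b, rfl⟩ := Fin.exists_castSucc_eq.mpr hl
    have := (hT.2.1 _ _ (succAbove_mem_insertCherry.mp hr)).1
    rw [Equiv.apply_symm_apply] at this
    exact Or.inl this

theorem cnat_le_ncard_lowestInternalAt (h : IsInsertion σ q w π)
    (hw : π.symm (Fin.last m) < w) :
    cnat σ ≤ {T | T ∈ CNATsOf π ∧ LowestInternalAt π w T}.ncard :=
  Set.ncard_le_ncard_of_injOn (insertCherry w (σ.symm q) q)
    (fun _ hT => ⟨insertCherry_mem h hw hT, lowestInternalAt_insertCherry h hT⟩)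
    insertCherry_injective.injOn (Set.toFinite _)

end

theorem sum_cnat_deletePerm_le_aux {m : ℕ} (π : Equiv.Perm (Fin (m + 1)))
    (W : Finset (Fin (m + 1))) (hW : ∀ w ∈ W, π.symm (Fin.last m) < w) :
    ∑ w ∈ W, cnat (deletePerm π w) ≤
      {T | T ∈ CNATsOf π ∧ ∃ w ∈ W, LowestInternalAt π w T}.ncard := by
  induction W using Finset.induction_on with
  | empty => simp
  | insert a W ha ih =>
    have hset : {T | T ∈ CNATsOf π ∧ ∃ w ∈ insert a W, LowestInternalAt π w T} =
        {T | T ∈ CNATsOf π ∧ LowestInternalAt π a T} ∪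
          {T | T ∈ CNATsOf π ∧ ∃ w ∈ W, LowestInternalAt π w T} := by
      ext T
      simp only [Finset.exists_mem_insert, Set.mem_ofPred_eq, Set.mem_union]
      tauto
    have ha' := hW a (Finset.mem_insert_self _ _)
    have hal := apply_ne_last_of_symm_lt ha'
    obtain ⟨q, hq⟩ := Fin.exists_castSucc_eq.mpr hal
    rw [Finset.sum_insert ha, hset, Set.ncard_union_eq _ (Set.toFinite _) (Set.toFinite _)]
    · exact add_le_add (cnat_le_ncard_lowestInternalAt (isInsertion_deletePerm π hq.symm) ha')
        (ih fun w hw => hW w (Finset.mem_insert_of_mem hw))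
    · rw [Set.disjoint_left]
      rintro T ⟨-, h1⟩ ⟨-, w, hw, h2⟩
      have := h1.unique hal (apply_ne_last_of_symm_lt (hW w (Finset.mem_insert_of_mem hw))) h2
      exact ha (this ▸ hw)

theorem sum_cnat_deletePerm_le {m : ℕ} (π : Equiv.Perm (Fin (m + 1)))
    (W : Finset (Fin (m + 1))) (hW : ∀ w ∈ W, π.symm (Fin.last m) < w) :
    ∑ w ∈ W, cnat (deletePerm π w) ≤ cnat π :=
  (sum_cnat_deletePerm_le_aux π W hW).trans
    (Set.ncard_le_ncard (fun _ h => h.1) (Set.toFinite _))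

/-! ### Exact counts when the new leaf lies in the last but one row -/

section

variable {l : ℕ} {σ : Equiv.Perm (Fin (l + 1))} {w : Fin (l + 2)}
  {π : Equiv.Perm (Fin (l + 2))}

theorem eq_last_of_castSucc_last_le {x : Fin (l + 2)} (h : (Fin.last l).castSucc ≤ x)
    (h' : x ≠ (Fin.last l).castSucc) : x = Fin.last (l + 1) := by
  rw [Fin.le_def] at h
  rw [Ne, Fin.ext_iff] at h'
  rw [Fin.ext_iff]
  simp at h h' ⊢
  omega

/-- The last but one row can have dots only in column `w` and in the column of the bottom leaf,
since each dot lies weakly above the leaf of its column. So the left parent of the leaf of `w` is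
the dot above the bottom leaf. Column `w` and the bottom row hold nothing but their leaves, so the
cherry can be removed. -/
theorem exists_of_mem_CNATsLeft (h : IsInsertion σ (Fin.last l) w π)
    (hw : π.symm (Fin.last (l + 1)) < w) {T' : GridFilling (l + 2) (l + 2)}
    (hT' : T' ∈ CNATsLeft π w) :
    ∃ T ∈ CNATsOf σ, insertCherry w (σ.symm (Fin.last l)) (Fin.last l) T = T' := by
  obtain ⟨hT', hleft⟩ := hT'
  rw [mem_CNATsOf_iff] at hT'
  obtain ⟨ha, hb, hc⟩ := hT'
  have hw0 : (w : ℕ) ≠ 0 := fun h0 => by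
    rw [Fin.lt_def, h0] at hw
    exact Nat.not_lt_zero _ hw
  have hab : ¬ T'.DotAbove (w, π w) := by
    rcases hc _ _ (ha w) (fun h' => hw0 h'.1) with h' | h'
    · exact absurd hleft h'.2
    · exact h'.2
  have hrow : ∀ k, (k, (Fin.last l).castSucc) ∈ T' → k ≠ w →
      k = w.succAbove (σ.symm (Fin.last l)) := by
    intro k hk hkw
    have h1 := eq_last_of_castSucc_last_le (hb _ _ hk).1 fun h' =>
      hkw (π.injective (h'.trans h.1.symm))
    rw [← h.symm_last, Equiv.eq_symm_apply, h1]
  have hp : (w.succAbove (σ.symm (Fin.last l)), (Fin.last l).castSucc) ∈ T' := by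
    obtain ⟨k, hk, hkT⟩ := hleft
    simp only [h.1] at hk hkT
    rwa [← hrow k hkT hk.ne]
  let T : GridFilling (l + 1) (l + 1) :=
    Finset.univ.filter fun c => (w.succAbove c.1, c.2.castSucc) ∈ T'
  have hTmem : ∀ k r, (k, r) ∈ T ↔ (w.succAbove k, r.castSucc) ∈ T' := by
    intro k r
    simp [T]
  have hTT' : insertCherry w (σ.symm (Fin.last l)) (Fin.last l) T = T' := by
    ext ⟨k, r⟩
    rcases insert_cell_cases w k r with rfl | rfl | ⟨a, b, rfl, rfl⟩
    · rw [mem_insertCherry_last, ← h.symm_last]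
      constructor
      · rintro rfl
        simpa using ha (π.symm (Fin.last (l + 1)))
      · intro hk
        rw [Equiv.eq_symm_apply]
        exact le_antisymm (Fin.le_last _) (hb _ _ hk).1
    · rw [mem_insertCherry_col, ← h.1]
      constructor
      · rintro rfl
        exact ha _
      · intro hr
        by_contra hne
        exact hab ⟨r, lt_of_le_of_ne (hb _ _ hr).1 hne, hr⟩
    · rw [succAbove_mem_insertCherry, hTmem]
  refine ⟨T, ?_, hTT'⟩
  rw [mem_CNATsOf_iff]
  refine ⟨fun k => ?_, fun k r hkr => ?_, fun k r hkr h0 => ?_⟩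
  · rw [hTmem]
    by_cases hk : σ k = Fin.last l
    · rw [hk]
      rwa [← hk, Equiv.symm_apply_apply, hk] at hp
    · have := ha (w.succAbove k)
      rwa [h.2, if_neg hk] at this
  · rw [hTmem] at hkr
    have := hb _ _ hkr
    rw [h.2] at this
    constructor
    · by_cases hk : σ k = Fin.last l
      · rw [hk]
        exact Fin.le_last _
      · rw [if_neg hk] at this
        exact this.1
    · by_cases hr : r = Fin.last l
      · subst hr
        exact (Fin.succAbove_right_injective (hrow _ hkr (Fin.succAbove_ne _ _))).le
      · rw [h.symm_castSucc hr] at this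
        exact Fin.succAbove_le_succAbove_iff.mp this.2
  · have hl : T'.DotLeft (w.succAbove k, r.castSucc) ↔ T.DotLeft (k, r) := by
      conv_lhs => rw [← hTT']
      refine ⟨dotLeft_of_insertCherry fun hr => ?_, dotLeft_insertCherry_of⟩
      subst hr
      rw [hTmem] at hkr
      have := hrow _ hkr (Fin.succAbove_ne _ _)
      rw [this, ← h.symm_last]
      exact hw
    have hab : T'.DotAbove (w.succAbove k, r.castSucc) ↔ T.DotAbove (k, r) := by
      conv_lhs => rw [← hTT']
      exact dotAbove_insertCherry
    rw [← hl, ← hab]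
    refine hc _ _ ((hTmem _ _).mp hkr) fun h' => h0 ⟨?_, by simpa using h'.2⟩
    have h1 := h'.1
    rcases lt_or_ge k.castSucc w with h2 | h2
    · rw [Fin.succAbove_of_castSucc_lt _ _ h2] at h1
      simpa using h1
    · rw [Fin.succAbove_of_le_castSucc _ _ h2] at h1
      simp at h1

theorem ncard_CNATsLeft (h : IsInsertion σ (Fin.last l) w π)
    (hw : π.symm (Fin.last (l + 1)) < w) : (CNATsLeft π w).ncard = cnat σ := by
  have himg : CNATsLeft π w =
      insertCherry w (σ.symm (Fin.last l)) (Fin.last l) '' CNATsOf σ := by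
    ext T'
    constructor
    · exact exists_of_mem_CNATsLeft h hw
    · rintro ⟨T, hT, rfl⟩
      exact ⟨insertCherry_mem h hw hT, ⟨_, hw, (lowestInternalAt_insertCherry h hT).1⟩⟩
  rw [himg, Set.ncard_image_of_injective _ insertCherry_injective, cnat]

/-- Adding a new last column whose leaf lies in the last but one row does not change the number of
CNATs. -/
theorem cnat_of_isInsertion_last (h : IsInsertion σ (Fin.last l) (Fin.last (l + 1)) π) :
    cnat π = cnat σ := by
  rw [cnat_eq_left_add_above π (Fin.last (l + 1)) (by simp), ncard_CNATsLeft h,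
    add_eq_left, Set.ncard_eq_zero, Set.eq_empty_iff_forall_notMem]
  · rintro T ⟨hT, s, hs, hsT⟩
    rw [mem_CNATsOf_iff] at hT
    have h1 := le_antisymm (Fin.le_last _) (hT.2.1 _ _ hsT).2
    simp only [Equiv.symm_apply_eq] at h1
    exact hs.ne h1
  · rw [h.symm_last]
    exact lt_of_le_of_ne (Fin.le_last _) (Fin.succAbove_ne _ _)

/-- The fixed leaf has its parent to the left or above. `ncard_CNATsLeft` counts the first kind by
`cnat σ`, and after transposition the second by `cnat σ.symm`. The condition `1 ≤ l` keeps this leaf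
away from the root cell. -/
theorem cnat_of_isInsertion_fixed (h : IsInsertion σ (Fin.last l) (Fin.last l).castSucc π)
    (hl : 1 ≤ l) : cnat π = 2 * cnat σ := by
  have hfix : ∀ {σ : Equiv.Perm (Fin (l + 1))} {π : Equiv.Perm (Fin (l + 2))},
      IsInsertion σ (Fin.last l) (Fin.last l).castSucc π → ∀ i,
        π ((Fin.last l).castSucc.succAbove i) = (Fin.last l).castSucc.succAbove (σ i) := by
    intro σ π h i
    rw [h.2]
    split_ifs with hi
    · rw [hi, Fin.succAbove_castSucc_self, Fin.succ_last]
    · rw [Fin.succAbove_of_castSucc_lt]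
      exact lt_of_le_of_ne (Fin.castSucc_le_castSucc_iff.mpr (Fin.le_last _))
        fun h' => hi (Fin.castSucc_injective _ h')
  have hsymm : IsInsertion σ.symm (Fin.last l) (Fin.last l).castSucc π.symm := by
    have h1 := isInsertion_insertPerm σ.symm (Fin.last l) (Fin.last l).castSucc
    convert h1
    ext1 i
    rw [Equiv.symm_apply_eq]
    rcases Fin.eq_self_or_eq_succAbove (Fin.last l).castSucc i with hi | ⟨j, rfl⟩
    · rw [hi, h1.1, h.1]
    · rw [hfix h1, hfix h, Equiv.apply_symm_apply]
  have hlast : Fin.last (l + 1) = (Fin.last l).castSucc.succAbove (Fin.last l) := by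
    rw [Fin.succAbove_castSucc_self, Fin.succ_last]
  -- If `σ` fixes the last point, so does `π`, and both counts vanish; otherwise the bottom leaf of
  -- `π` lies left of the inserted column, as `ncard_CNATsLeft` requires.
  by_cases hσ : σ (Fin.last l) = Fin.last l
  · rw [cnat_eq_zero_of_fix_last hl σ hσ, cnat_eq_zero_of_fix_last (by omega) π]
    rw [hlast, hfix h, hσ]
  · have hlt : ∀ x : Fin (l + 2), x ≠ (Fin.last l).castSucc → x ≠ Fin.last (l + 1) →
        x < (Fin.last l).castSucc := by
      intro x h1 h2
      rw [Ne, Fin.ext_iff] at h1 h2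
      rw [Fin.lt_def]
      have := x.isLt
      simp at h1 h2 ⊢
      omega
    have hne : π (Fin.last (l + 1)) ≠ Fin.last (l + 1) := by
      rw [hlast, hfix h]
      exact fun h' => hσ (Fin.succAbove_right_injective h')
    have hne' : π (Fin.last (l + 1)) ≠ (Fin.last l).castSucc := by
      rw [hlast, hfix h]
      exact Fin.succAbove_ne _ _
    have hne2 : π.symm (Fin.last (l + 1)) ≠ (Fin.last l).castSucc := by
      rw [hlast, hfix hsymm]
      exact Fin.succAbove_ne _ _
    rw [cnat_eq_left_add_above π (Fin.last l).castSucc (by simp; omega), ncard_CNATsAbove, h.1,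
      ncard_CNATsLeft h (hlt _ hne2 fun h' => hne ?_), ncard_CNATsLeft hsymm, cnat_symm, two_mul]
    · rw [Equiv.symm_symm]
      exact hlt _ hne' hne
    · rw [Equiv.symm_apply_eq] at h'
      exact h'.symm

end

/-! ### Indecomposable permutations and deletable columns -/

/-- `π` maps no proper nonempty final segment of positions to itself; equivalently, its inversion
graph is connected. -/
def IsIndecomposable {n : ℕ} (π : Equiv.Perm (Fin n)) : Prop :=
  ∀ k : ℕ, 0 < k → k < n → ∃ i : Fin n, k ≤ (i : ℕ) ∧ (π i : ℕ) < k

/-- A permutation which preserves a final segment preserves the complementary initial segment. -/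
theorem apply_lt_of_forall_le {n k : ℕ} {π : Equiv.Perm (Fin n)}
    (h : ∀ i : Fin n, k ≤ (i : ℕ) → k ≤ (π i : ℕ)) {j : Fin n} (hj : (j : ℕ) < k) :
    (π j : ℕ) < k := by
  by_contra hk
  let S : Finset (Fin n) := Finset.univ.filter fun i => k ≤ (i : ℕ)
  have hS : S.image π = S := by
    refine Finset.eq_of_subset_of_card_le ?_ (Finset.card_image_of_injective _ π.injective).ge
    intro x hx
    obtain ⟨i, hi, rfl⟩ := Finset.mem_image.mp hx
    simpa [S] using h i (by simpa [S] using hi)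
  have hmem : π j ∈ S.image π := by
    rw [hS]
    simpa [S] using hk
  obtain ⟨i, hi, hij⟩ := Finset.mem_image.mp hmem
  rw [π.injective hij] at hi
  have : k ≤ (j : ℕ) := by simpa [S] using hi
  omega

theorem IsIndecomposable.symm {n : ℕ} {π : Equiv.Perm (Fin n)} (h : IsIndecomposable π) :
    IsIndecomposable π.symm := by
  intro k h0 hk
  by_contra! hcon
  obtain ⟨i, hi, hik⟩ := h k h0 hk
  have := apply_lt_of_forall_le hcon hik
  rw [Equiv.symm_apply_apply] at this
  omega

/-- If positions from `k` on are preserved, the parent of a dot in the lower right block stays in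
that block, so a dot of the block with minimal coordinate sum has no parent. It is not the root
cell, because `k > 0`. -/
theorem cnat_eq_zero_of_not_isIndecomposable {n : ℕ} {π : Equiv.Perm (Fin n)}
    (h : ¬ IsIndecomposable π) : cnat π = 0 := by
  simp only [IsIndecomposable, not_forall, not_exists, not_and, not_lt] at h
  obtain ⟨k, h0, hk, hcl⟩ := h
  rw [cnat, Set.ncard_eq_zero, Set.eq_empty_iff_forall_notMem]
  intro T hT
  rw [mem_CNATsOf_iff] at hT
  obtain ⟨ha, hb, hc⟩ := hT
  obtain ⟨⟨c, r⟩, hcr, hmin⟩ := (T.filter fun c => k ≤ (c.1 : ℕ) ∧ k ≤ (c.2 : ℕ)).exists_min_image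
    (fun c => (c.1 : ℕ) + (c.2 : ℕ))
    ⟨(⟨k, hk⟩, π ⟨k, hk⟩), by simpa using ⟨ha _, hcl ⟨k, hk⟩ le_rfl⟩⟩
  simp only [Finset.mem_filter, and_imp, Prod.forall] at hcr hmin
  obtain ⟨hT, hck, hrk⟩ := hcr
  rcases hc _ _ hT (by omega) with ⟨⟨s, hs, hsT⟩, -⟩ | ⟨⟨s, hs, hsT⟩, -⟩
  · have hsk : k ≤ (s : ℕ) := by
      have h1 := (hb _ _ hsT).2
      rw [Fin.le_def] at h1
      simpa using hcl (π.symm s) (hck.trans h1)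
    have := hmin c s hsT hck hsk
    rw [Fin.lt_def] at hs
    simp only at hs
    omega
  · have hsk : k ≤ (s : ℕ) := by
      by_contra hlt
      have h1 := (hb _ _ hsT).1
      have h2 := apply_lt_of_forall_le hcl (not_le.mp hlt)
      rw [Fin.le_def] at h1
      simp only at h1
      omega
    have := hmin s r hsT hsk hrk
    rw [Fin.lt_def] at hs
    simp only at hs
    omega

theorem exists_succAbove_val {m : ℕ} {w i : Fin (m + 1)} (h : i ≠ w) :
    ∃ j : Fin m, w.succAbove j = i ∧
      ((i : ℕ) < w ∧ (j : ℕ) = i ∨ (w : ℕ) < i ∧ (j : ℕ) + 1 = i) := by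
  obtain ⟨j, rfl⟩ := Fin.exists_succAbove_eq h
  refine ⟨j, rfl, ?_⟩
  rcases lt_or_ge j.castSucc w with h' | h'
  · rw [Fin.succAbove_of_castSucc_lt _ _ h']
    exact Or.inl ⟨h', rfl⟩
  · rw [Fin.succAbove_of_le_castSucc _ _ h']
    rw [Fin.le_def] at h'
    simp at h' ⊢
    omega

theorem deletePerm_val {m : ℕ} (π : Equiv.Perm (Fin (m + 1))) {w i : Fin (m + 1)} {j : Fin m}
    (hj : w.succAbove j = i) :
    (deletePerm π w j : ℕ) = if i = π.symm (Fin.last m) then (π w : ℕ) else (π i : ℕ) := by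
  have h := castSucc_deletePerm π (w := w) j
  rw [hj] at h
  simp only [Equiv.eq_symm_apply]
  split_ifs at h ⊢ with h' <;> rw [← h, Fin.val_castSucc]

/-- The obstruction to deleting column `w` from an indecomposable permutation. -/
theorem exists_of_not_isIndecomposable_deletePerm {m : ℕ} {π : Equiv.Perm (Fin (m + 1))}
    (hπ : IsIndecomposable π) {w : Fin (m + 1)} (hw : π.symm (Fin.last m) < w)
    (h : ¬ IsIndecomposable (deletePerm π w)) :
    ∃ k : ℕ, (π.symm (Fin.last m) : ℕ) < k ∧ k < m ∧ ∃ u : Fin (m + 1), k ≤ (u : ℕ) ∧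
      (∀ i : Fin (m + 1), k ≤ (i : ℕ) → i ≠ u → k ≤ (π i : ℕ)) ∧ (w = u ∨ (w : ℕ) < k) := by
  simp only [IsIndecomposable, not_forall, not_exists, not_and, not_lt] at h
  obtain ⟨k, h0, hk, hcl⟩ := h
  have key : ∀ {i : Fin (m + 1)} {j : Fin m}, w.succAbove j = i → k ≤ (j : ℕ) →
      k ≤ (π i : ℕ) := by
    intro i j hj hkj
    have h1 := hcl j hkj
    rw [deletePerm_val π hj] at h1
    split_ifs at h1 with h2
    · rw [h2, Equiv.apply_symm_apply]
      simpa using hk.le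
    · exact h1
  rw [Fin.lt_def] at hw
  rcases le_or_gt k (w : ℕ) with hkw | hkw
  · have hi : ∀ i : Fin (m + 1), k ≤ (i : ℕ) → i ≠ w → k ≤ (π i : ℕ) := by
      intro i hki hiw
      obtain ⟨j, hj, hv⟩ := exists_succAbove_val hiw
      exact key hj (by omega)
    refine ⟨k, ?_, hk, w, hkw, hi, Or.inl rfl⟩
    -- If `k` were at most the position of the bottom leaf, that leaf would take over the value `π
    -- w`, giving `k ≤ π w`; then `π` itself would preserve the segment from `k` on.
    by_contra hp
    obtain ⟨j, hj, hv⟩ := exists_succAbove_val (w := w) (i := π.symm (Fin.last m))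
      fun h' => by rw [h'] at hw; omega
    have h1 := hcl j (by omega)
    rw [deletePerm_val π hj, if_pos rfl] at h1
    obtain ⟨i, hki, hik⟩ := hπ k h0 (by omega)
    by_cases hiw : i = w
    · rw [hiw] at hik
      omega
    · have := hi i hki hiw
      omega
  -- Columns right of `w` shift by one, so the segment from `k` in the deletion covers only the
  -- columns from `k + 1` in `π`; column `k` is the exception.
  · refine ⟨k, by omega, hk, ⟨k, by omega⟩, le_rfl, fun i hki hik => ?_, Or.inr hkw⟩
    have hne : (i : ℕ) ≠ k := fun h' => hik (Fin.ext h')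
    obtain ⟨j, hj, hv⟩ := exists_succAbove_val (w := w) (i := i)
      fun h' => by rw [h'] at hki; omega
    exact key hj (by omega)

theorem IsIndecomposable.symm_last_lt {m : ℕ} {π : Equiv.Perm (Fin (m + 1))}
    (hπ : IsIndecomposable π) (hm : 1 ≤ m) : (π.symm (Fin.last m) : ℕ) < m := by
  obtain ⟨i, hi, hlt⟩ := hπ.symm m hm (by omega)
  have : i = Fin.last m := Fin.ext (by have := i.isLt; simp; omega)
  rwa [this] at hlt

/-- A final segment in which all columns but one can be deleted. -/
theorem exists_deletable_segment {m : ℕ} {π : Equiv.Perm (Fin (m + 1))}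
    (hπ : IsIndecomposable π) (hm : 1 ≤ m) :
    ∃ (k : ℕ) (u : Fin (m + 1)), k < m ∧ k ≤ (u : ℕ) ∧
      (k = (π.symm (Fin.last m) : ℕ) ∧ u = π.symm (Fin.last m) ∨
        (π.symm (Fin.last m) : ℕ) < k ∧
          ∀ i : Fin (m + 1), k ≤ (i : ℕ) → i ≠ u → k ≤ (π i : ℕ)) ∧
      ∀ w : Fin (m + 1), k ≤ (w : ℕ) → w ≠ u →
        π.symm (Fin.last m) < w ∧ IsIndecomposable (deletePerm π w) := by
  classical
  set p := π.symm (Fin.last m) with hp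
  let Q : ℕ → Prop := fun k => (p : ℕ) < k ∧ k < m ∧ ∃ u : Fin (m + 1), k ≤ (u : ℕ) ∧
    ∀ i : Fin (m + 1), k ≤ (i : ℕ) → i ≠ u → k ≤ (π i : ℕ)
  by_cases hQ : ∃ k, Q k
  · obtain ⟨k0, hk0⟩ := hQ
    -- With `k` maximal, an obstruction to deleting `w` sits at some `k' ≤ k ≤ w` and has `w` as its
    -- exceptional column. Indecomposability then gives `π w < k'`, whereas `w ≠ u` gives `k ≤ π w`.
    obtain ⟨k, hk, hmax⟩ := ((Finset.range m).filter Q).exists_max_image id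
      ⟨k0, by simpa using ⟨hk0.2.1, hk0⟩⟩
    simp only [Finset.mem_filter, Finset.mem_range, id] at hk hmax
    obtain ⟨hkm, hpk, -, u, hku, hu⟩ := hk
    refine ⟨k, u, hkm, hku, Or.inr ⟨hpk, hu⟩, fun w hkw hwu => ?_⟩
    have hpw : p < w := by
      rw [Fin.lt_def]
      omega
    refine ⟨hpw, ?_⟩
    by_contra hcon
    obtain ⟨k', h1, h2, u', h3, h4, h5⟩ := exists_of_not_isIndecomposable_deletePerm hπ hpw hcon
    have hle := hmax k' ⟨h2, h1, h2, u', h3, h4⟩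
    have hwu' : w = u' := h5.resolve_right (by omega)
    subst hwu'
    obtain ⟨i, hi, hik⟩ := hπ k' (by omega) (by omega)
    have : i = w := by
      by_contra hiw
      have := h4 i hi hiw
      omega
    subst this
    have := hu i hkw hwu
    omega
  · refine ⟨p, p, hπ.symm_last_lt hm, le_rfl, Or.inl ⟨rfl, rfl⟩, fun w hkw hwu => ?_⟩
    have hpw : p < w := lt_of_le_of_ne hkw (Ne.symm hwu)
    refine ⟨hpw, ?_⟩
    by_contra hcon
    obtain ⟨k', h1, h2, u', h3, h4, -⟩ := exists_of_not_isIndecomposable_deletePerm hπ hpw hcon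
    exact hQ ⟨k', h1, h2, u', h3, h4⟩

theorem cnat_fin_one (π : Equiv.Perm (Fin 1)) : cnat π = 1 := by
  rw [cnat, Set.ncard_eq_one]
  refine ⟨Finset.univ, ?_⟩
  ext T
  rw [mem_CNATsOf_iff, Set.mem_singleton_iff]
  constructor
  · rintro ⟨ha, -, -⟩
    ext ⟨k, r⟩
    have : r = π k := Subsingleton.elim _ _
    rw [this]
    simpa using ha k
  · rintro rfl
    refine ⟨fun _ => Finset.mem_univ _, fun k r _ => ?_, fun k r _ h0 => absurd ?_ h0⟩
    · exact ⟨(Subsingleton.elim _ _).le, (Subsingleton.elim _ _).le⟩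
    · omega

/-! ### Lower bounds 1, 2 and 3 for `cnat` -/

theorem card_le_cnat {m c : ℕ} {π : Equiv.Perm (Fin (m + 1))} {k : ℕ} {u : Fin (m + 1)}
    (hk : k < m)
    (h : ∀ w : Fin (m + 1), k ≤ (w : ℕ) → w ≠ u →
      π.symm (Fin.last m) < w ∧ c ≤ cnat (deletePerm π w)) : (m - k) * c ≤ cnat π := by
  have hW : ∀ w ∈ (Finset.Ici (⟨k, by omega⟩ : Fin (m + 1))).erase u,
      π.symm (Fin.last m) < w ∧ c ≤ cnat (deletePerm π w) := by
    intro w hw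
    rw [Finset.mem_erase, Finset.mem_Ici, Fin.le_def] at hw
    exact h w hw.2 hw.1
  have hcard : m - k ≤ ((Finset.Ici (⟨k, by omega⟩ : Fin (m + 1))).erase u).card := by
    have h1 := Finset.pred_card_le_card_erase
      (s := Finset.Ici (⟨k, by omega⟩ : Fin (m + 1))) (a := u)
    rw [Fin.card_Ici] at h1
    simp only at h1
    omega
  calc (m - k) * c ≤ _ * c := Nat.mul_le_mul_right _ hcard
    _ ≤ ∑ w ∈ (Finset.Ici (⟨k, by omega⟩ : Fin (m + 1))).erase u, cnat (deletePerm π w) := by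
      rw [← smul_eq_mul]
      exact Finset.card_nsmul_le_sum _ _ _ fun w hw => (hW w hw).2
    _ ≤ cnat π := sum_cnat_deletePerm_le π _ fun w hw => (hW w hw).1

theorem IsIndecomposable.one_le_cnat {m : ℕ} {π : Equiv.Perm (Fin (m + 1))}
    (hπ : IsIndecomposable π) : 1 ≤ cnat π := by
  induction m with
  | zero => rw [cnat_fin_one]
  | succ m ih =>
    obtain ⟨k, u, hk, -, -, hdel⟩ := exists_deletable_segment hπ (by omega)
    have := card_le_cnat (c := 1) hk fun w h1 h2 =>
      ⟨(hdel w h1 h2).1, ih (hdel w h1 h2).2⟩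
    omega

theorem cnat_of_apply_last {l : ℕ} {π : Equiv.Perm (Fin (l + 2))}
    (h : π (Fin.last (l + 1)) = (Fin.last l).castSucc) :
    cnat π = cnat (deletePerm π (Fin.last (l + 1))) :=
  cnat_of_isInsertion_last (isInsertion_deletePerm π h)

theorem cnat_of_fixed {l : ℕ} (hl : 1 ≤ l) {π : Equiv.Perm (Fin (l + 2))}
    (h : π (Fin.last l).castSucc = (Fin.last l).castSucc) :
    cnat π = 2 * cnat (deletePerm π (Fin.last l).castSucc) :=
  cnat_of_isInsertion_fixed (isInsertion_deletePerm π h) hl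

/-- If the lower right corner of the permutation has none of the three exceptional forms, then the
deletable segment has length at least three. -/
theorem segment_start_lt {l k : ℕ} {π : Equiv.Perm (Fin (l + 2))} {u : Fin (l + 2)}
    (hA : (π (Fin.last (l + 1)) : ℕ) ≠ l) (hB : (π.symm (Fin.last (l + 1)) : ℕ) ≠ l)
    (hC : π (Fin.last l).castSucc ≠ (Fin.last l).castSucc) (hk : k < l + 1)
    (h : k = (π.symm (Fin.last (l + 1)) : ℕ) ∧ u = π.symm (Fin.last (l + 1)) ∨
        (π.symm (Fin.last (l + 1)) : ℕ) < k ∧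
          ∀ i : Fin (l + 2), k ≤ (i : ℕ) → i ≠ u → k ≤ (π i : ℕ)) : k < l := by
  by_contra hkl
  have hkl : k = l := by omega
  subst hkl
  rcases h with h | ⟨h1, h2⟩
  · exact hB h.1.symm
  · have key : ∀ i : Fin (k + 2), k ≤ (i : ℕ) → i ≠ u → (π i : ℕ) = k := by
      intro i hi hiu
      have h3 := h2 i hi hiu
      have h4 : (π i : ℕ) ≠ k + 1 := by
        intro h5
        have : π i = Fin.last (k + 1) := Fin.ext h5
        rw [← this, Equiv.symm_apply_apply] at h1
        omega
      have := (π i).isLt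
      omega
    by_cases hu : u = Fin.last (k + 1)
    · refine hC (Fin.ext (key _ (by simp) ?_))
      rw [hu]
      exact Fin.castSucc_ne_last _
    · exact hA (key _ (by simp) (Ne.symm hu))

/-- Either the last but one point is fixed and `cnat π` is even and positive, or the segment offers
two deletable columns, each contributing at least one. -/
theorem IsIndecomposable.two_le_cnat {l : ℕ} {π : Equiv.Perm (Fin (l + 2))}
    (hπ : IsIndecomposable π) (hA : (π (Fin.last (l + 1)) : ℕ) ≠ l)
    (hB : (π.symm (Fin.last (l + 1)) : ℕ) ≠ l) : 2 ≤ cnat π := by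
  by_cases hl : l = 0
  · subst hl
    obtain ⟨i, hi, hlt⟩ := hπ 1 (by omega) (by omega)
    have : i = Fin.last 1 := Fin.ext (by have := i.isLt; simp; omega)
    rw [this] at hlt
    exact absurd (Nat.lt_one_iff.mp hlt) hA
  by_cases hC : π (Fin.last l).castSucc = (Fin.last l).castSucc
  · have h1 := hπ.one_le_cnat
    have h2 := cnat_of_fixed (by omega) hC
    omega
  · obtain ⟨k, u, hk, -, hseg, hdel⟩ := exists_deletable_segment hπ (by omega)
    have hkl := segment_start_lt hA hB hC hk hseg
    have := card_le_cnat (c := 1) hk fun w h1 h2 =>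
      ⟨(hdel w h1 h2).1, (hdel w h1 h2).2.one_le_cnat⟩
    omega

theorem three_le_cnat_of_two {m : ℕ} {π : Equiv.Perm (Fin (m + 1))} {w w' : Fin (m + 1)}
    (hne : w ≠ w') (hw : π.symm (Fin.last m) < w) (hw' : π.symm (Fin.last m) < w')
    (h : 2 ≤ cnat (deletePerm π w)) (h' : 1 ≤ cnat (deletePerm π w')) : 3 ≤ cnat π := by
  have := sum_cnat_deletePerm_le π {w, w'} (by
    intro x hx
    rw [Finset.mem_insert, Finset.mem_singleton] at hx
    rcases hx with rfl | rfl <;> assumption)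
  rw [Finset.sum_pair hne] at this
  omega

section

variable {t : ℕ} {π : Equiv.Perm (Fin (t + 3))}

theorem succAbove_eq_of_val {m : ℕ} {w i : Fin (m + 1)} {j : Fin m}
    (h : (i : ℕ) < w ∧ (j : ℕ) = i ∨ (w : ℕ) < i ∧ (j : ℕ) + 1 = i) : w.succAbove j = i := by
  obtain ⟨j', hj', hv⟩ := exists_succAbove_val (w := w) (i := i) fun h' => by
    rw [h'] at h
    omega
  rw [← hj']
  congr 1
  ext
  omega

theorem two_le_cnat_deletePerm {w : Fin (t + 3)} (hw : IsIndecomposable (deletePerm π w))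
    (hA : (deletePerm π w (Fin.last (t + 1)) : ℕ) ≠ t)
    (hB : (deletePerm π w (Fin.last t).castSucc : ℕ) ≠ t + 1) : 2 ≤ cnat (deletePerm π w) := by
  refine hw.two_le_cnat hA fun h => hB ?_
  have : (deletePerm π w).symm (Fin.last (t + 1)) = (Fin.last t).castSucc := Fin.ext h
  rw [← this, Equiv.apply_symm_apply]
  simp

/-- Both columns right of the bottom leaf are deletable. One of the two deletions avoids the
exceptional forms of `IsIndecomposable.two_le_cnat`; which one depends on whether the last but one
column takes the value `t`. -/
theorem three_le_cnat_of_symm_last (hπ : IsIndecomposable π)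
    (hA : (π (Fin.last (t + 2)) : ℕ) ≠ t + 1)
    (hC : π (Fin.last (t + 1)).castSucc ≠ (Fin.last (t + 1)).castSucc)
    (hp : (π.symm (Fin.last (t + 2)) : ℕ) = t) : 3 ≤ cnat π := by
  obtain ⟨k, u, hk, -, hseg, hdel⟩ := exists_deletable_segment hπ (by omega)
  have hB : (π.symm (Fin.last (t + 2)) : ℕ) ≠ t + 1 := by omega
  have hkl := segment_start_lt hA hB hC hk hseg
  obtain ⟨hkp, hup⟩ : k = (π.symm (Fin.last (t + 2)) : ℕ) ∧ u = π.symm (Fin.last (t + 2)) :=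
    hseg.resolve_right (by omega)
  have hu : (u : ℕ) = t := by rw [hup, hp]
  obtain ⟨h1, h1'⟩ := hdel (Fin.last (t + 2)) (by simp; omega)
    (fun h => by rw [← h] at hu; simp at hu)
  obtain ⟨h2, h2'⟩ := hdel (Fin.last (t + 1)).castSucc (by simp; omega)
    (fun h => by rw [← h] at hu; simp at hu)
  have hne : Fin.last (t + 2) ≠ (Fin.last (t + 1)).castSucc := (Fin.castSucc_ne_last _).symm
  by_cases hx : (π (Fin.last (t + 1)).castSucc : ℕ) = t
  · refine three_le_cnat_of_two hne.symm h2 h1 (two_le_cnat_deletePerm h2' ?_ ?_)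
      h1'.one_le_cnat
    · rw [deletePerm_val π (i := Fin.last (t + 2)) (succAbove_eq_of_val (by simp)),
        if_neg h1.ne']
      exact fun h => hne (π.injective (Fin.ext (h.trans hx.symm)))
    · rw [deletePerm_val π (i := π.symm (Fin.last (t + 2)))
        (succAbove_eq_of_val (by simp; omega)), if_pos rfl]
      exact fun h => hC (Fin.ext h)
  · refine three_le_cnat_of_two hne h1 h2 (two_le_cnat_deletePerm h1' ?_ ?_)
      h2'.one_le_cnat
    · rwa [deletePerm_val π (i := (Fin.last (t + 1)).castSucc) (succAbove_eq_of_val (by simp)),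
        if_neg h2.ne']
    · rw [deletePerm_val π (i := π.symm (Fin.last (t + 2)))
        (succAbove_eq_of_val (by simp; omega)), if_pos rfl]
      exact hA

theorem IsIndecomposable.three_le_cnat (hπ : IsIndecomposable π)
    (hA : (π (Fin.last (t + 2)) : ℕ) ≠ t + 1)
    (hB : (π.symm (Fin.last (t + 2)) : ℕ) ≠ t + 1)
    (hC : π (Fin.last (t + 1)).castSucc ≠ (Fin.last (t + 1)).castSucc) : 3 ≤ cnat π := by
  by_cases hp : (π.symm (Fin.last (t + 2)) : ℕ) = t
  · exact three_le_cnat_of_symm_last hπ hA hC hp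
  by_cases hr : (π (Fin.last (t + 2)) : ℕ) = t
  · rw [← cnat_symm]
    refine three_le_cnat_of_symm_last hπ.symm hB (fun h => hC ?_) hr
    rw [Equiv.symm_apply_eq] at h
    exact h.symm
  obtain ⟨k, u, hk, hku, hseg, hdel⟩ := exists_deletable_segment hπ (by omega)
  have hkl := segment_start_lt hA hB hC hk hseg
  have hcard := card_le_cnat (c := 1) hk fun w h1 h2 =>
    ⟨(hdel w h1 h2).1, (hdel w h1 h2).2.one_le_cnat⟩
  by_cases hkt : k < t
  · omega
  have hkt : k = t := by omega
  subst hkt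
  -- Only two deletable columns remain. The bottom leaf lies left of the segment, so the columns
  -- other than `u` take the values `k` and `k + 1`; the excluded cases force `u` to be last and the
  -- last but one column to take `k`. Deleting column `k` then contributes two.
  obtain ⟨hpk, hval⟩ := hseg.resolve_left fun h => hp h.1.symm
  have key : ∀ i : Fin (k + 3), k ≤ (i : ℕ) → i ≠ u → (π i : ℕ) = k ∨ (π i : ℕ) = k + 1 := by
    intro i hi hiu
    have h3 := hval i hi hiu
    have h4 : (π i : ℕ) ≠ k + 2 := by
      intro h5
      have : π i = Fin.last (k + 2) := Fin.ext h5
      rw [← this, Equiv.symm_apply_apply] at hpk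
      omega
    have := (π i).isLt
    omega
  have hu : u = Fin.last (k + 2) := by
    by_contra h
    rcases key (Fin.last (k + 2)) (by simp) (Ne.symm h) with h' | h'
    · exact hr h'
    · exact hA h'
  have hx : (π (Fin.last (k + 1)).castSucc : ℕ) = k :=
    (key _ (by simp) (by rw [hu]; exact Fin.castSucc_ne_last _)).resolve_right
      fun h => hC (Fin.ext h)
  obtain ⟨h1, h1'⟩ := hdel (Fin.last k).castSucc.castSucc (by simp)
    (by rw [hu]; exact Fin.castSucc_ne_last _)
  obtain ⟨h2, h2'⟩ := hdel (Fin.last (k + 1)).castSucc (by simp)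
    (by rw [hu]; exact Fin.castSucc_ne_last _)
  refine three_le_cnat_of_two (fun h => ?_) h1 h2 (two_le_cnat_deletePerm h1' ?_ ?_)
    h2'.one_le_cnat
  · simp [Fin.ext_iff] at h
  · rwa [deletePerm_val π (i := Fin.last (k + 2)) (succAbove_eq_of_val (by simp)), if_neg]
    intro h
    rw [← h] at hpk
    simp at hpk
  · rw [deletePerm_val π (i := (Fin.last (k + 1)).castSucc) (succAbove_eq_of_val (by simp)),
      if_neg h2.ne', hx]
    omega

end

/-! ### Recurrences and the final count -/

/-- Counting permutations with a prescribed value by deleting the corresponding column. -/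
theorem ncard_apply_eq_of_isInsertion {m j : ℕ} {q : Fin m} {w : Fin (m + 1)} (f : ℕ → ℕ)
    (hf : ∀ (σ : Equiv.Perm (Fin m)) (π : Equiv.Perm (Fin (m + 1))), IsInsertion σ q w π →
      cnat π = f (cnat σ)) :
    {π : Equiv.Perm (Fin (m + 1)) | π w = q.castSucc ∧ cnat π = j}.ncard =
      {σ : Equiv.Perm (Fin m) | f (cnat σ) = j}.ncard := by
  have himg : {π : Equiv.Perm (Fin (m + 1)) | π w = q.castSucc ∧ cnat π = j} =
      (fun σ => insertPerm σ q w) '' {σ : Equiv.Perm (Fin m) | f (cnat σ) = j} := by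
    ext π
    constructor
    · rintro ⟨hw, hj⟩
      have h := isInsertion_deletePerm π hw
      exact ⟨deletePerm π w, (hf _ _ h).symm.trans hj, (isInsertion_insertPerm _ q w).perm_eq h⟩
    · rintro ⟨σ, hσ, rfl⟩
      have h := isInsertion_insertPerm σ q w
      exact ⟨h.1, (hf _ _ h).trans hσ⟩
  rw [himg, Set.ncard_image_of_injective]
  intro σ σ' h
  have h1 := isInsertion_insertPerm σ q w
  rw [show insertPerm σ q w = insertPerm σ' q w from h] at h1
  exact h1.eq_of_perm (isInsertion_insertPerm σ' q w)

theorem ncard_apply_last {l : ℕ} (j : ℕ) :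
    {π : Equiv.Perm (Fin (l + 2)) |
      π (Fin.last (l + 1)) = (Fin.last l).castSucc ∧ cnat π = j}.ncard =
      (permsWithCNATs (l + 1) j).ncard :=
  ncard_apply_eq_of_isInsertion id fun _ _ h => cnat_of_isInsertion_last h

theorem ncard_symm_apply_last {l : ℕ} (j : ℕ) :
    {π : Equiv.Perm (Fin (l + 2)) |
      π.symm (Fin.last (l + 1)) = (Fin.last l).castSucc ∧ cnat π = j}.ncard =
      (permsWithCNATs (l + 1) j).ncard := by
  rw [← ncard_apply_last]
  refine Set.ncard_congr (fun π _ => π.symm) (fun π h => ⟨h.1, (cnat_symm π).trans h.2⟩)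
    (fun π π' _ _ h => ?_) fun π h => ⟨π.symm, ⟨h.1, (cnat_symm π).trans h.2⟩, rfl⟩
  rw [← Equiv.symm_symm π, h, Equiv.symm_symm]

theorem ncard_fixed {l : ℕ} (hl : 1 ≤ l) (j : ℕ) :
    {π : Equiv.Perm (Fin (l + 2)) |
      π (Fin.last l).castSucc = (Fin.last l).castSucc ∧ cnat π = j}.ncard =
      {σ : Equiv.Perm (Fin (l + 1)) | 2 * cnat σ = j}.ncard :=
  ncard_apply_eq_of_isInsertion (fun c => 2 * c) fun _ _ h => cnat_of_isInsertion_fixed h hl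

/-- As `1 ≤ j ≤ 2`, only the three exceptional forms contribute. They are disjoint: the first two
together would make the deletion fix its last point, so `cnat` would be zero, and the third excludes
the others by injectivity. -/
theorem ncard_permsWithCNATs_rec {t j : ℕ} (hj : 1 ≤ j) (hj2 : j ≤ 2) :
    (permsWithCNATs (t + 3) j).ncard = 2 * (permsWithCNATs (t + 2) j).ncard +
      {σ : Equiv.Perm (Fin (t + 2)) | 2 * cnat σ = j}.ncard := by
  have hsplit : permsWithCNATs (t + 3) j =
      ({π : Equiv.Perm (Fin (t + 3)) |
          π (Fin.last (t + 2)) = (Fin.last (t + 1)).castSucc ∧ cnat π = j} ∪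
        {π : Equiv.Perm (Fin (t + 3)) |
          π.symm (Fin.last (t + 2)) = (Fin.last (t + 1)).castSucc ∧ cnat π = j}) ∪
        {π : Equiv.Perm (Fin (t + 3)) |
          π (Fin.last (t + 1)).castSucc = (Fin.last (t + 1)).castSucc ∧ cnat π = j} := by
    ext π
    constructor
    · intro h
      have h : cnat π = j := h
      by_cases hA : π (Fin.last (t + 2)) = (Fin.last (t + 1)).castSucc
      · exact Or.inl (Or.inl ⟨hA, h⟩)
      by_cases hB : π.symm (Fin.last (t + 2)) = (Fin.last (t + 1)).castSucc
      · exact Or.inl (Or.inr ⟨hB, h⟩)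
      by_cases hC : π (Fin.last (t + 1)).castSucc = (Fin.last (t + 1)).castSucc
      · exact Or.inr ⟨hC, h⟩
      exfalso
      by_cases hπ : IsIndecomposable π
      · have := hπ.three_le_cnat (fun h' => hA (Fin.ext h')) (fun h' => hB (Fin.ext h')) hC
        omega
      · have := cnat_eq_zero_of_not_isIndecomposable hπ
        omega
    · rintro ((h | h) | h) <;> exact h.2
  rw [hsplit, Set.ncard_union_eq _ (Set.toFinite _) (Set.toFinite _),
    Set.ncard_union_eq _ (Set.toFinite _) (Set.toFinite _), ncard_apply_last,
    ncard_symm_apply_last, ncard_fixed (by omega), two_mul]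
  · rw [Set.disjoint_left]
    rintro π ⟨hA, hcA⟩ ⟨hB, -⟩
    rw [Equiv.symm_apply_eq] at hB
    have h1 : deletePerm π (Fin.last (t + 2)) (Fin.last (t + 1)) = Fin.last (t + 1) := by
      apply Fin.castSucc_injective
      rw [castSucc_deletePerm, Fin.succAbove_last, ← hB, if_pos rfl, hA]
    rw [cnat_of_apply_last hA, cnat_eq_zero_of_fix_last (by omega) _ h1] at hcA
    omega
  · rw [Set.disjoint_left]
    rintro π (⟨hA, -⟩ | ⟨hB, -⟩) ⟨hC, -⟩
    · exact Fin.castSucc_ne_last _ (π.injective (hC.trans hA.symm))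
    · rw [Equiv.symm_apply_eq, hC] at hB
      exact Fin.castSucc_ne_last _ hB.symm

/-- Base case outside the recurrence: for size two the first two exceptional forms coincide in the
transposition. -/
theorem ncard_permsWithCNATs_two {j : ℕ} (hj : 1 ≤ j) :
    (permsWithCNATs 2 j).ncard = (permsWithCNATs 1 j).ncard := by
  rw [← ncard_apply_last (l := 0)]
  congr 1
  ext π
  constructor
  · intro h
    refine ⟨?_, h⟩
    by_contra hne
    have h1 : π (Fin.last 1) = Fin.last 1 := by
      have hlt := (π (Fin.last 1)).isLt
      have hne' : (π (Fin.last 1) : ℕ) ≠ 0 := fun h' => hne (Fin.ext h')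
      ext
      simp only [Fin.val_last]
      omega
    have h2 := cnat_eq_zero_of_fix_last le_rfl π h1
    have h3 : cnat π = j := h
    omega
  · exact fun h => h.2

theorem permsWithCNATs_one_one : (permsWithCNATs 1 1).ncard = 1 := by
  have : permsWithCNATs 1 1 = {1} := by
    ext π
    simp [permsWithCNATs, cnat_fin_one, Subsingleton.elim π 1]
  rw [this, Set.ncard_singleton]

theorem permsWithCNATs_one_two : (permsWithCNATs 1 2).ncard = 0 := by
  have : permsWithCNATs 1 2 = ∅ := by
    ext π
    simp [permsWithCNATs, cnat_fin_one]
  rw [this, Set.ncard_empty]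

theorem ncard_permsWithCNATs_one (l : ℕ) : (permsWithCNATs (l + 2) 1).ncard = 2 ^ l := by
  induction l with
  | zero => rw [ncard_permsWithCNATs_two le_rfl, permsWithCNATs_one_one, pow_zero]
  | succ l ih =>
    have h0 : {σ : Equiv.Perm (Fin (l + 2)) | 2 * cnat σ = 1} = ∅ := by
      rw [Set.eq_empty_iff_forall_notMem]
      intro σ hσ
      have hσ : 2 * cnat σ = 1 := hσ
      omega
    rw [ncard_permsWithCNATs_rec le_rfl one_le_two, ih, h0, Set.ncard_empty]
    ring

theorem two_mul_ncard_permsWithCNATs_two (l : ℕ) :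
    2 * (permsWithCNATs (l + 2) 2).ncard = l * 2 ^ l := by
  induction l with
  | zero => rw [ncard_permsWithCNATs_two one_le_two, permsWithCNATs_one_two, zero_mul, mul_zero]
  | succ l ih =>
    have h1 : {σ : Equiv.Perm (Fin (l + 2)) | 2 * cnat σ = 2} = permsWithCNATs (l + 2) 1 := by
      ext σ
      change 2 * cnat σ = 2 ↔ cnat σ = 1
      omega
    rw [ncard_permsWithCNATs_rec one_le_two le_rfl, h1, ncard_permsWithCNATs_one, mul_add, ih]
    ring

theorem mainTheorem6 (n : ℕ) (hn : 2 ≤ n) :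
    ((permsWithCNATs n 2).ncard : ℚ) = ((n : ℚ) - 2) * (2 : ℚ) ^ ((n : ℤ) - 3) := by
  obtain ⟨l, rfl⟩ := Nat.exists_eq_add_of_le' hn
  have h : (2 : ℚ) * ((permsWithCNATs (l + 2) 2).ncard : ℚ) = l * 2 ^ l := by
    exact_mod_cast two_mul_ncard_permsWithCNATs_two l
  have hexp : (((l + 2 : ℕ) : ℤ) - 3) = (l : ℤ) - 1 := by
    push_cast
    ring
  -- For `n = 2` the exponent is negative, hence the integer power over `ℚ` and the doubled count in
  -- `h`.
  rw [hexp, zpow_sub₀ two_ne_zero, zpow_natCast, zpow_one]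
  push_cast
  linarith
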